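/- Let $\mathbb{H}$ be the upper half plane with the metric $(dx^2+dy^2)/y^2$, let $T_1\mathbb{H}$ be its unit tangent bundle, let $T_1\mathcal{M}=\mathrm{PSL}_2(\mathbb{Z})\backslash T_1\mathbb{H}$ be the unit tangent bundle of the modular surface, and let $g_t$ denote the geodesic flow on both. For $(z,v)\in T_1\mathbb{H}$ let $\alpha(z,v)$ and $\beta(z,v)$ be the endpoints of its geodesic at times $-\infty$ and $+\infty$. Let $\bar X\subset T_1\mathcal{M}$ be the set of classes of those $(z,v)$ with $z\in i\mathbb{R}_{>0}$, $\alpha(z,v)\in\mathbb{R}\setminus\{0\}$, $\beta(z,v)\in\mathbb{R}$ and $|\beta(z,v)|\ge 1$, and give such a class the coordinates $$(U,W,\epsilon)=\left(|\beta|^{-1},\,(1+|\alpha|)^{-1},\,\operatorname{sign}\beta\right)\in(0,1]\times(0,1)\times\{\pm1\}.$$ Let $\tilde F:[0,1]^2\to[0,1]^2$ be the natural extension of the Farey map, $$\tilde F(x,y)=\begin{cases}\left(\frac{x}{1-x},\frac{y}{1+y}\right)&\text{if }0\le x\le\frac12,\\[4pt]\left(\frac{1-x}{x},\frac{1}{1+y}\right)&\text{if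 }\frac12<x\le1.\end{cases}$$ Then $\bar X$ is the set of classes of all nonvertical unit vectors based on the positive imaginary axis. Every triple in $(0,1]\times(0,1)\times\{\pm1\}$ is a coordinate triple of exactly one point of $\bar X$, and every point of $\bar X$ has such a triple. The triple is unique, except that $(1,W,\epsilon)$ and $(1,1-W,-\epsilon)$ denote the same point. The first return time $\bar r(x)=\min\{s>0: g_s(x)\in\bar X\}$ and the first return map $\bar P(x)=g_{\bar r(x)}(x)$ are defined exactly on the set $\bar X^*$ of the points $x\in\bar X$ with $U<1$. For all $(U,W,\epsilon)\in(0,1)^2\times\{\pm1\}$, $$\bar P(U,W,\epsilon)=\begin{cases}(\tilde F(U,W),\epsilon)&\text{if }0<U\le\frac12,\\(\tilde F(U,W),-\epsilon)&\text{if }\frac12<U<1,\end{cases}\qquad \bar r(U,W,\epsilon)=-\tfrac12\log\big((1-U)(1-W)\big).$$ Consequently $\tilde F$ is a factor of $\bar P$: if $\bar\pi:\bar X\to[0,1]^2$ is the map $(U,W,\epsilon)\mapsto(U,W)$, where the triple with $W\le\frac12$ is used for a point with $U=1$, then $\bar\pi$ is well defined and $\bar\pi\circ\bar P=\tilde F\circ\bar\pi$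 on $\bar X^*$. -/

import Mathlib

open Set Filter Topology
open scoped UpperHalfPlane MatrixGroups

noncomputable section

namespace ModularFarey

/-- The unit tangent bundle `T₁ℍ` of the upper half plane with the metric `(dx² + dy²) / y²`: a
tangent vector `vec` at `base` has hyperbolic length `‖vec‖ / base.im`. -/
@[ext]
structure UnitTangent where
  base : ℍ
  vec : ℂ
  norm_vec : ‖vec‖ = base.im

theorem im_smul_eq (γ : SL(2, ℝ)) (z : ℍ) :
    (γ • z).im = z.im / ‖(γ 1 0 : ℂ) * (z : ℂ) + (γ 1 1 : ℂ)‖ ^ 2 := by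
  have h := UpperHalfPlane.im_smul_eq_div_normSq (γ : GL (Fin 2) ℝ) z
  rw [Complex.normSq_eq_norm_sq] at h
  have hs : ((γ : GL (Fin 2) ℝ) • z : ℍ) = γ • z := rfl
  rw [hs] at h
  simpa [UpperHalfPlane.denom] using h

/-- `SL(2, ℝ)` acts by Möbius maps and their derivatives, `γ (z, v) = (γ z, γ'(z) v)`, where
`γ'(z) = (c z + d)⁻²` for `γ` with lower row `c, d`. -/
instance : SMul SL(2, ℝ) UnitTangent where
  smul γ p :=
    { base := γ • p.base
      vec := p.vec / ((γ 1 0 : ℂ) * (p.base : ℂ) + (γ 1 1 : ℂ)) ^ 2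
      norm_vec := by rw [norm_div, norm_pow, p.norm_vec, im_smul_eq] }

theorem base_smul (γ : SL(2, ℝ)) (p : UnitTangent) : (γ • p).base = γ • p.base := rfl

theorem vec_smul (γ : SL(2, ℝ)) (p : UnitTangent) :
    (γ • p).vec = p.vec / ((γ 1 0 : ℂ) * (p.base : ℂ) + (γ 1 1 : ℂ)) ^ 2 := rfl

instance : MulAction SL(2, ℝ) UnitTangent where
  one_smul p := by
    apply UnitTangent.ext
    · rw [base_smul, one_smul]
    · rw [vec_smul]; simp
  mul_smul g h p := by
    apply UnitTangent.ext
    · rw [base_smul, base_smul, base_smul, mul_smul]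
    · rw [vec_smul, vec_smul, vec_smul, base_smul]
      have key := UpperHalfPlane.denom_cocycle' (g : GL (Fin 2) ℝ) (h : GL (Fin 2) ℝ) p.base
      have hs : UpperHalfPlane.smulAux (h : GL (Fin 2) ℝ) p.base = h • p.base := rfl
      have hk : (((g * h : SL(2, ℝ)) 1 0 : ℝ) : ℂ) * (p.base : ℂ)
            + (((g * h : SL(2, ℝ)) 1 1 : ℝ) : ℂ)
          = ((g 1 0 : ℂ) * ((h • p.base : ℍ) : ℂ) + (g 1 1 : ℂ))
            * ((h 1 0 : ℂ) * (p.base : ℂ) + (h 1 1 : ℂ)) := by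
        have h2 : UpperHalfPlane.σ (h : GL (Fin 2) ℝ) = ContinuousAlgEquiv.refl ℝ ℂ := by
          simp [UpperHalfPlane.σ]
        rw [h2, hs] at key
        simpa [UpperHalfPlane.denom] using key
      rw [hk, mul_pow, mul_comm, div_div]

/-- The modular group acts on `T₁ℍ` through `SL(2, ℤ) → SL(2, ℝ)`. Since `-1` acts trivially, its
orbits are those of `PSL(2, ℤ)`. -/
instance : MulAction SL(2, ℤ) UnitTangent :=
  MulAction.compHom UnitTangent (Matrix.SpecialLinearGroup.map (n := Fin 2) (Int.castRingHom ℝ))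

/-- The upward-pointing unit vector at `i`. -/
def upVector : UnitTangent where
  base := UpperHalfPlane.I
  vec := Complex.I
  norm_vec := by simp

theorem exists_smul_upVector (p : UnitTangent) : ∃ γ : SL(2, ℝ), γ • upVector = p := by
  have hy : (0 : ℝ) < p.base.im := p.base.im_pos
  have hv : p.vec ≠ 0 := by
    intro h
    have := p.norm_vec
    rw [h, norm_zero] at this
    exact hy.ne this
  obtain ⟨w, hw⟩ : ∃ w : ℂ, w ^ 2 = Complex.I * (p.base.im : ℂ) / p.vec :=
    IsAlgClosed.exists_pow_nat_eq _ (by norm_num)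
  have hn : w.re ^ 2 + w.im ^ 2 = 1 := by
    have h1 : ‖w‖ ^ 2 = 1 := by
      rw [← norm_pow, hw, norm_div, norm_mul, Complex.norm_I, p.norm_vec, one_mul,
        Complex.norm_real, Real.norm_of_nonneg hy.le, div_self hy.ne']
    rw [← Complex.normSq_eq_norm_sq, Complex.normSq_apply] at h1
    nlinarith
  have hw0 : w ≠ 0 := by
    rintro rfl
    simp at hn
  let k : SL(2, ℝ) := ⟨!![w.re, -w.im; w.im, w.re], by rw [Matrix.det_fin_two_of]; nlinarith⟩
  have hkd : (k 1 0 : ℂ) * ((UpperHalfPlane.I : ℍ) : ℂ) + (k 1 1 : ℂ) = w := by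
    apply Complex.ext <;> simp [k]
  have hkI : k • UpperHalfPlane.I = UpperHalfPlane.I := by
    apply UpperHalfPlane.ext
    rw [UpperHalfPlane.specialLinearGroup_apply]
    have hnum : ((k 0 0 : ℝ) : ℂ) * Complex.I + ((k 0 1 : ℝ) : ℂ) = Complex.I * w := by
      apply Complex.ext <;> simp [k]
    have hkd' : ((k 1 0 : ℝ) : ℂ) * Complex.I + ((k 1 1 : ℝ) : ℂ) = w := hkd
    simp only [UpperHalfPlane.coe_I, Algebra.algebraMap_self, RingHom.id_apply]
    change (((k 0 0 : ℝ) : ℂ) * Complex.I + ((k 0 1 : ℝ) : ℂ))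
      / (((k 1 0 : ℝ) : ℂ) * Complex.I + ((k 1 1 : ℝ) : ℂ)) = Complex.I
    rw [hnum, hkd', mul_div_assoc, div_self hw0, mul_one]
  refine ⟨p.base.toSL2R * k, ?_⟩
  rw [mul_smul]
  apply UnitTangent.ext
  · rw [base_smul, base_smul]
    change p.base.toSL2R • (k • UpperHalfPlane.I) = p.base
    rw [hkI, UpperHalfPlane.toSL2R_smul_I]
  · rw [vec_smul, vec_smul]
    change Complex.I / ((k 1 0 : ℂ) * ((UpperHalfPlane.I : ℍ) : ℂ) + (k 1 1 : ℂ)) ^ 2 / _ = _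
    rw [hkd, hw]
    have hs : ((√p.base.im : ℝ) : ℂ) ^ 2 = (p.base.im : ℂ) := by
      rw [← Complex.ofReal_pow, Real.sq_sqrt hy.le]
    have hyc : (p.base.im : ℂ) ≠ 0 := by exact_mod_cast hy.ne'
    simp only [UpperHalfPlane.coe_toSL2R, Matrix.of_apply, Matrix.cons_val', Matrix.cons_val_zero,
      Matrix.cons_val_one, Matrix.cons_val_fin_one, Complex.ofReal_zero, zero_mul, zero_add,
      Complex.ofReal_div, Complex.ofReal_one, div_pow, one_pow, hs]
    field_simp

/-- The diagonal matrix with entries `exp (t / 2)` and `exp (-t / 2)`. -/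
def diagExp (t : ℝ) : SL(2, ℝ) :=
  ⟨!![Real.exp (t / 2), 0; 0, Real.exp (-t / 2)], by
    rw [Matrix.det_fin_two_of, ← Real.exp_add]; simp [neg_div]⟩

/-- The geodesic flow on `T₁ℍ`. The unit speed geodesic that leaves `i` upwards has at time `t` the
tangent vector `diagExp t • upVector`, that is, the vector `exp t • i` at the point `exp t • i`;
the isometry `γ` carries it to the unit speed geodesic with initial vector `γ • upVector`. -/
def geodesicFlow (t : ℝ) (p : UnitTangent) : UnitTangent :=
  ((exists_smul_upVector p).choose * diagExp t) • upVector

theorem smul_upVector_eq_self {k : SL(2, ℝ)} (h : k • upVector = upVector) : k = 1 ∨ k = -1 := by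
  have hb : k • UpperHalfPlane.I = UpperHalfPlane.I := congrArg UnitTangent.base h
  have hv : Complex.I / ((k 1 0 : ℂ) * Complex.I + (k 1 1 : ℂ)) ^ 2 = Complex.I :=
    congrArg UnitTangent.vec h
  have hne : ((k 1 0 : ℂ) * Complex.I + (k 1 1 : ℂ)) ^ 2 ≠ 0 := by
    intro h0
    rw [h0, div_zero] at hv
    exact Complex.I_ne_zero hv.symm
  have hsq : ((k 1 0 : ℂ) * Complex.I + (k 1 1 : ℂ)) ^ 2 = 1 := by
    rw [div_eq_iff hne] at hv
    exact (mul_left_cancel₀ Complex.I_ne_zero (by rw [mul_one]; exact hv)).symm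
  have hb' := congrArg (fun z : ℍ => (z : ℂ)) hb
  simp only [UpperHalfPlane.specialLinearGroup_apply] at hb'
  have hd : ((k 1 0 : ℂ) * Complex.I + (k 1 1 : ℂ)) ≠ 0 := fun h0 => hne (by rw [h0]; simp)
  have hb2 : ((k 0 0 : ℂ) * Complex.I + (k 0 1 : ℂ))
      = Complex.I * ((k 1 0 : ℂ) * Complex.I + (k 1 1 : ℂ)) := by
    rw [← div_eq_iff hd]
    exact hb'
  have e1 : k 0 1 = -k 1 0 := by simpa using congrArg Complex.re hb2
  have e2 : k 0 0 = k 1 1 := by simpa using congrArg Complex.im hb2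
  rcases sq_eq_one_iff.mp hsq with h1 | h1
  all_goals
    have a1 := congrArg Complex.re h1
    have a2 := congrArg Complex.im h1
    simp at a1 a2
  · left
    ext i j
    fin_cases i <;> fin_cases j <;> simp [e1, e2, a1, a2]
  · right
    ext i j
    fin_cases i <;> fin_cases j <;> simp [e1, e2, a1, a2]

/-- The geodesic flow corresponds to right multiplication by `diagExp t`. -/
theorem geodesicFlow_smul_upVector (t : ℝ) (γ : SL(2, ℝ)) :
    geodesicFlow t (γ • upVector) = (γ * diagExp t) • upVector := by
  unfold geodesicFlow
  set g := (exists_smul_upVector (γ • upVector)).choose with hg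
  have h : g • upVector = γ • upVector := (exists_smul_upVector (γ • upVector)).choose_spec
  have hk : (γ⁻¹ * g) • upVector = upVector := by
    rw [mul_smul, h, inv_smul_smul]
  have hneg (x : SL(2, ℝ)) : (-x) • upVector = x • upVector := by
    apply UnitTangent.ext
    · rw [base_smul, base_smul]
      apply UpperHalfPlane.ext
      simp only [UpperHalfPlane.specialLinearGroup_apply]
      simp only [Matrix.SpecialLinearGroup.coe_neg, Matrix.neg_apply, map_neg, Complex.ofReal_neg,
        neg_mul]
      rw [← neg_add, ← neg_add, neg_div_neg_eq]
    · rw [vec_smul, vec_smul]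
      simp only [Matrix.SpecialLinearGroup.coe_neg, Matrix.neg_apply, Complex.ofReal_neg, neg_mul]
      rw [← neg_add, neg_sq]
  rcases smul_upVector_eq_self hk with h1 | h1
  · rw [inv_mul_eq_one.mp h1]
  · rw [show g = -γ by rw [inv_mul_eq_iff_eq_mul] at h1; rw [h1]; simp, neg_mul, hneg]

theorem geodesicFlow_smul (t : ℝ) (γ : SL(2, ℝ)) (p : UnitTangent) :
    geodesicFlow t (γ • p) = γ • geodesicFlow t p := by
  obtain ⟨g, rfl⟩ := exists_smul_upVector p
  rw [← mul_smul, geodesicFlow_smul_upVector, geodesicFlow_smul_upVector, ← mul_smul, mul_assoc]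

/-- The unit tangent bundle `T₁ℳ = PSL(2, ℤ) \ T₁ℍ` of the modular surface. -/
abbrev ModularTangent : Type := MulAction.orbitRel.Quotient SL(2, ℤ) UnitTangent

/-- The projection `T₁ℍ → T₁ℳ`. -/
def toModular (p : UnitTangent) : ModularTangent := Quotient.mk _ p

/-- The geodesic flow on `T₁ℳ`. -/
def modularFlow (t : ℝ) : ModularTangent → ModularTangent :=
  Quotient.map (geodesicFlow t) (by
    rintro _ q ⟨γ, rfl⟩
    exact ⟨γ, (geodesicFlow_smul t _ q).symm⟩)

/-- `a` is the real endpoint at time `-∞` of the geodesic tangent to `p`. -/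
def IsBackwardEndpoint (p : UnitTangent) (a : ℝ) : Prop :=
  Tendsto (fun t : ℝ => ((geodesicFlow t p).base : ℂ)) atBot (𝓝 (a : ℂ))

/-- `b` is the real endpoint at time `∞` of the geodesic tangent to `p`. -/
def IsForwardEndpoint (p : UnitTangent) (b : ℝ) : Prop :=
  Tendsto (fun t : ℝ => ((geodesicFlow t p).base : ℂ)) atTop (𝓝 (b : ℂ))

/-- `p` is a vector with base point on the positive imaginary axis whose geodesic has the real
endpoints `a ≠ 0` (backward) and `b` with `1 ≤ |b|` (forward). -/
structure IsSectionLift (p : UnitTangent) (a b : ℝ) : Prop where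
  re_base : p.base.re = 0
  backward : IsBackwardEndpoint p a
  forward : IsForwardEndpoint p b
  backward_ne_zero : a ≠ 0
  one_le_abs_forward : 1 ≤ |b|

/-- The cross section of the geodesic flow on `T₁ℳ`. -/
def crossSection : Set ModularTangent :=
  {x | ∃ p a b, toModular p = x ∧ IsSectionLift p a b}

/-- The point `x` of the cross section has coordinates `(U, W, ε)`: it is represented by a vector
based on the positive imaginary axis with endpoints `α ≠ 0` (backward) and `β`, `|β| ≥ 1` (forward),
such that `U = |β|⁻¹`, `W = (1 + |α|)⁻¹` and `ε` is the sign of `β`. -/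
def HasCoordinates (x : ModularTangent) (U W : ℝ) (ε : ℤˣ) : Prop :=
  ∃ p a b, toModular p = x ∧ IsSectionLift p a b ∧
    U = |b|⁻¹ ∧ W = (1 + |a|)⁻¹ ∧ (((ε : ℤ) : ℝ)) = Real.sign b

/-- The positive times at which the orbit of `x` meets the cross section. -/
def returnTimes (x : ModularTangent) : Set ℝ := {s | 0 < s ∧ modularFlow s x ∈ crossSection}

/-- The points of the cross section for which a first return time exists. -/
def returnDomain : Set ModularTangent :=
  {x | x ∈ crossSection ∧ ∃ r, IsLeast (returnTimes x) r}

/-- The first return time (meaningful on `returnDomain`, where the infimum is a minimum). -/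
def returnTime (x : ModularTangent) : ℝ := sInf (returnTimes x)

/-- The first return map of the cross section. -/
def returnMap (x : returnDomain) : crossSection :=
  ⟨modularFlow (returnTime x) x, by
    obtain ⟨r, hr⟩ := x.2.2
    have h : returnTime x = r := hr.csInf_eq
    rw [h]
    exact hr.1.2⟩

/-- The natural extension of the Farey map (a self-map of the unit square `[0, 1]²`). -/
def fareyExtension (p : ℝ × ℝ) : ℝ × ℝ :=
  if p.1 ≤ 1 / 2 then (p.1 / (1 - p.1), p.2 / (1 + p.2))
  else ((1 - p.1) / p.1, 1 / (1 + p.2))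

/-- `π` is the projection `(U, W, ε) ↦ (U, W)` from the cross section to the plane. A point with
`U = 1` has two coordinate triples, `(1, W, ε)` and `(1, 1 - W, -ε)`, and `π` reads off the one
with `W ≤ 1 / 2`. -/
def IsCoordinateProjection (π : crossSection → ℝ × ℝ) : Prop :=
  ∀ (x : crossSection) (U W : ℝ) (ε : ℤˣ),
    HasCoordinates x U W ε → (U < 1 ∨ W ≤ 1 / 2) → π x = (U, W)

end ModularFarey

end

open ModularFarey

/-!
A vector on the imaginary axis is determined by the endpoints of its geodesic. Let the forward
endpoint be `β` with sign `ε` and `1 ≤ |β|`. The geodesic leaves the axis into the ideal triangle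
with vertices `0`, `ε`, `∞`, whose interior meets no image of the axis under the modular group, and
it leaves the triangle through the side `Re = ε` if `1 < |β|`, or ends at the vertex `ε` if
`|β| = 1`. The translation by `-ε` brings this side back to the axis and acts on the coordinates as
`(U, W, ε) ↦ (U / (1 - U), W / (1 + W), ε)`. If the new forward endpoint lies inside the unit
interval, the inversion `(U, W, ε) ↦ (U⁻¹, 1 - W, -ε)` is applied as well; this gives the two
branches of the Farey map. The stabilizer of the axis is generated by the inversion, which accounts
for the two triples of a point with `U = 1`.
-/

namespace ModularFarey

section Endpoints

theorem tendsto_nhds_iff_eq_mul {ι 𝕜 : Type*} [GroupWithZero 𝕜] [TopologicalSpace 𝕜] [T2Space 𝕜]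
    [ContinuousMul 𝕜] [ContinuousInv₀ 𝕜] {l : Filter ι} [l.NeBot] {f A B : ι → 𝕜} {A₀ B₀ z : 𝕜}
    (hA : Tendsto A l (𝓝 A₀)) (hB : Tendsto B l (𝓝 B₀)) (h0 : A₀ ≠ 0 ∨ B₀ ≠ 0)
    (hf : ∀ t, f t * B t = A t) : Tendsto f l (𝓝 z) ↔ A₀ = z * B₀ := by
  constructor
  · intro h
    exact tendsto_nhds_unique hA ((h.mul hB).congr hf)
  · intro h
    have hB₀ : B₀ ≠ 0 := fun hB₀ => h0.elim (· (by rw [h, hB₀, mul_zero])) (· hB₀)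
    rw [← div_eq_of_eq_mul hB₀ h]
    refine (hA.div hB hB₀).congr' ?_
    filter_upwards [hB.eventually_ne hB₀] with t ht
    exact (eq_div_of_mul_eq ht (hf t)).symm

theorem det_fin_two_eq_one {R : Type*} [CommRing R] (g : SL(2, R)) :
    g 0 0 * g 1 1 - g 0 1 * g 1 0 = 1 := by
  rw [← Matrix.det_fin_two, g.det_coe]

theorem denom_ne_zero (g : SL(2, ℝ)) (z : ℍ) : (g 1 0 : ℂ) * z + g 1 1 ≠ 0 :=
  UpperHalfPlane.denom_ne_zero (g : GL (Fin 2) ℝ) z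

theorem coe_smul_mul_denom (g : SL(2, ℝ)) (z : ℍ) :
    ((g • z : ℍ) : ℂ) * (g 1 0 * z + g 1 1) = g 0 0 * z + g 0 1 := by
  rw [UpperHalfPlane.coe_specialLinearGroup_apply]
  exact div_mul_cancel₀ _ (denom_ne_zero g z)

theorem UnitTangent.neg_smul (g : SL(2, ℝ)) (p : UnitTangent) : -g • p = g • p := by
  apply UnitTangent.ext
  · exact UpperHalfPlane.neg_smul g p.base
  · simp only [vec_smul, Matrix.SpecialLinearGroup.coe_neg, Matrix.neg_apply, Complex.ofReal_neg,
      neg_mul, ← neg_add, neg_sq]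

theorem coe_diagExp_smul_I (t : ℝ) :
    ((diagExp t • UpperHalfPlane.I : ℍ) : ℂ) = Real.exp t * Complex.I := by
  have hexp : Real.exp (t / 2) = Real.exp t * Real.exp (-t / 2) := by
    rw [← Real.exp_add]; congr 1; ring
  have h : ((diagExp t • UpperHalfPlane.I : ℍ) : ℂ) * ((0 : ℝ) * Complex.I + Real.exp (-t / 2))
      = Real.exp (t / 2) * Complex.I + (0 : ℝ) := coe_smul_mul_denom (diagExp t) UpperHalfPlane.I
  refine mul_right_cancel₀ (Complex.ofReal_ne_zero.mpr (Real.exp_pos (-t / 2)).ne') ?_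
  rw [hexp, Complex.ofReal_mul, Complex.ofReal_zero] at h
  linear_combination h

theorem coe_base_geodesicFlow_smul_upVector_mul (t : ℝ) (M : SL(2, ℝ)) :
    ((geodesicFlow t (M • upVector)).base : ℂ) * (M 1 0 * (Real.exp t * Complex.I) + M 1 1)
      = M 0 0 * (Real.exp t * Complex.I) + M 0 1 := by
  rw [geodesicFlow_smul_upVector, mul_smul, base_smul, base_smul, ← coe_diagExp_smul_I]
  exact coe_smul_mul_denom M _

theorem isBackwardEndpoint_smul_upVector_iff {M : SL(2, ℝ)} {a : ℝ} :
    IsBackwardEndpoint (M • upVector) a ↔ M 0 1 = a * M 1 1 := by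
  have hlim (m n : ℝ) :
      Tendsto (fun t : ℝ => (m * (Real.exp t * Complex.I) + n : ℂ)) atBot (𝓝 n) := by
    have h := (Complex.continuous_ofReal.tendsto 0).comp Real.tendsto_exp_atBot
    simpa using ((h.mul_const Complex.I).const_mul (m : ℂ)).add_const (n : ℂ)
  have h0 : (M 0 1 : ℂ) ≠ 0 ∨ (M 1 1 : ℂ) ≠ 0 := by
    by_contra! h
    simpa [Complex.ofReal_eq_zero.mp h.1, Complex.ofReal_eq_zero.mp h.2] using det_fin_two_eq_one M
  rw [IsBackwardEndpoint, tendsto_nhds_iff_eq_mul (hlim _ _) (hlim _ _) h0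
    (coe_base_geodesicFlow_smul_upVector_mul · M)]
  exact_mod_cast Iff.rfl

theorem isForwardEndpoint_smul_upVector_iff {M : SL(2, ℝ)} {b : ℝ} :
    IsForwardEndpoint (M • upVector) b ↔ M 0 0 = b * M 1 0 := by
  have hlim (m n : ℝ) :
      Tendsto (fun t : ℝ => (m * Complex.I + n * Real.exp (-t) : ℂ)) atTop
        (𝓝 (m * Complex.I)) := by
    have h := (Complex.continuous_ofReal.tendsto 0).comp Real.tendsto_exp_neg_atTop_nhds_zero
    simpa using (h.const_mul (n : ℂ)).const_add (m * Complex.I : ℂ)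
  have h0 : (M 0 0 * Complex.I : ℂ) ≠ 0 ∨ (M 1 0 * Complex.I : ℂ) ≠ 0 := by
    by_contra! h
    have h1 := Complex.ofReal_eq_zero.mp ((mul_eq_zero_iff_right Complex.I_ne_zero).mp h.1)
    have h2 := Complex.ofReal_eq_zero.mp ((mul_eq_zero_iff_right Complex.I_ne_zero).mp h.2)
    simpa [h1, h2] using det_fin_two_eq_one M
  have hflow (t : ℝ) : ((geodesicFlow t (M • upVector)).base : ℂ)
      * (M 1 0 * Complex.I + M 1 1 * Real.exp (-t))
      = M 0 0 * Complex.I + M 0 1 * Real.exp (-t) := by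
    have hexp : (Real.exp t : ℂ) * Real.exp (-t) = 1 := by
      rw [← Complex.ofReal_mul, ← Real.exp_add, add_neg_cancel, Real.exp_zero, Complex.ofReal_one]
    linear_combination (Real.exp (-t) : ℂ) * coe_base_geodesicFlow_smul_upVector_mul t M
      + (M 0 0 - (geodesicFlow t (M • upVector)).base * M 1 0) * Complex.I * hexp
  rw [IsForwardEndpoint, tendsto_nhds_iff_eq_mul (hlim _ _) (hlim _ _) h0 hflow, ← mul_assoc,
    mul_left_inj' Complex.I_ne_zero]
  exact_mod_cast Iff.rfl

theorem mul_apply_fin_two {R : Type*} [CommRing R] (g h : SL(2, R)) (i j : Fin 2) :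
    (g * h) i j = g i 0 * h 0 j + g i 1 * h 1 j := by
  rw [Matrix.SpecialLinearGroup.coe_mul, Matrix.mul_apply, Fin.sum_univ_two]

theorem mul_diagExp_apply_zero (M : SL(2, ℝ)) (t : ℝ) (i : Fin 2) :
    (M * diagExp t) i 0 = M i 0 * Real.exp (t / 2) := by
  rw [mul_apply_fin_two]
  simp [diagExp]

theorem mul_diagExp_apply_one (M : SL(2, ℝ)) (t : ℝ) (i : Fin 2) :
    (M * diagExp t) i 1 = M i 1 * Real.exp (-t / 2) := by
  rw [mul_apply_fin_two]
  simp [diagExp]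

variable {p : UnitTangent} {a b a' b' : ℝ}

theorem IsBackwardEndpoint.smul {g : SL(2, ℝ)} (h : IsBackwardEndpoint p a)
    (hg : g 0 0 * a + g 0 1 = a' * (g 1 0 * a + g 1 1)) : IsBackwardEndpoint (g • p) a' := by
  obtain ⟨M, rfl⟩ := exists_smul_upVector p
  rw [isBackwardEndpoint_smul_upVector_iff] at h
  rw [← mul_smul, isBackwardEndpoint_smul_upVector_iff, mul_apply_fin_two, mul_apply_fin_two]
  linear_combination (g 0 0 - a' * g 1 0) * h + M 1 1 * hg

theorem IsForwardEndpoint.smul {g : SL(2, ℝ)} (h : IsForwardEndpoint p b)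
    (hg : g 0 0 * b + g 0 1 = b' * (g 1 0 * b + g 1 1)) : IsForwardEndpoint (g • p) b' := by
  obtain ⟨M, rfl⟩ := exists_smul_upVector p
  rw [isForwardEndpoint_smul_upVector_iff] at h
  rw [← mul_smul, isForwardEndpoint_smul_upVector_iff, mul_apply_fin_two, mul_apply_fin_two]
  linear_combination (g 0 0 - b' * g 1 0) * h + M 1 0 * hg

theorem IsBackwardEndpoint.int_smul {γ : SL(2, ℤ)} (h : IsBackwardEndpoint p a)
    (hγ : γ 0 0 * a + γ 0 1 = a' * (γ 1 0 * a + γ 1 1)) : IsBackwardEndpoint (γ • p) a' :=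
  h.smul (g := γ) hγ

theorem IsForwardEndpoint.int_smul {γ : SL(2, ℤ)} (h : IsForwardEndpoint p b)
    (hγ : γ 0 0 * b + γ 0 1 = b' * (γ 1 0 * b + γ 1 1)) : IsForwardEndpoint (γ • p) b' :=
  h.smul (g := γ) hγ

theorem IsBackwardEndpoint.geodesicFlow (h : IsBackwardEndpoint p a) (t : ℝ) :
    IsBackwardEndpoint (geodesicFlow t p) a := by
  obtain ⟨M, rfl⟩ := exists_smul_upVector p
  rw [isBackwardEndpoint_smul_upVector_iff] at h
  rw [geodesicFlow_smul_upVector, isBackwardEndpoint_smul_upVector_iff, mul_diagExp_apply_one,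
    mul_diagExp_apply_one, h, mul_assoc]

theorem IsForwardEndpoint.geodesicFlow (h : IsForwardEndpoint p b) (t : ℝ) :
    IsForwardEndpoint (geodesicFlow t p) b := by
  obtain ⟨M, rfl⟩ := exists_smul_upVector p
  rw [isForwardEndpoint_smul_upVector_iff] at h
  rw [geodesicFlow_smul_upVector, isForwardEndpoint_smul_upVector_iff, mul_diagExp_apply_zero,
    mul_diagExp_apply_zero, h, mul_assoc]

end Endpoints

open scoped ComplexConjugate

section Tangents

variable {p : UnitTangent} {a b : ℝ}

theorem vec_smul_upVector_mul (M : SL(2, ℝ)) :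
    (M • upVector).vec * (M 1 0 * Complex.I + M 1 1) ^ 2 = Complex.I := by
  rw [vec_smul]
  exact div_mul_cancel₀ _ (pow_ne_zero 2 (denom_ne_zero M UpperHalfPlane.I))

theorem coe_base_smul_upVector_mul (M : SL(2, ℝ)) :
    ((M • upVector).base : ℂ) * (M 1 0 * Complex.I + M 1 1) = M 0 0 * Complex.I + M 0 1 :=
  coe_smul_mul_denom M UpperHalfPlane.I

theorem conj_base_smul_upVector_mul (M : SL(2, ℝ)) :
    conj ((M • upVector).base : ℂ) * (M 1 0 * -Complex.I + M 1 1) = M 0 0 * -Complex.I + M 0 1 := by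
  simpa using congrArg conj (coe_base_smul_upVector_mul M)

theorem im_base_smul_upVector_mul (M : SL(2, ℝ)) :
    ((M • upVector).base.im : ℂ) * ((M 1 0 * Complex.I + M 1 1) * (M 1 0 * -Complex.I + M 1 1))
      = 1 := by
  have hconj : (M 1 0 * -Complex.I + M 1 1 : ℂ) = conj (M 1 0 * Complex.I + M 1 1 : ℂ) := by simp
  have h := congrArg norm (vec_smul_upVector_mul M)
  rw [norm_mul, norm_pow, UnitTangent.norm_vec, Complex.norm_I] at h
  rw [hconj, Complex.mul_conj']
  exact_mod_cast h

theorem isForwardEndpoint_iff_vec_mul : IsForwardEndpoint p b ↔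
    p.vec * (b - conj (p.base : ℂ)) = Complex.I * p.base.im * (b - p.base) := by
  obtain ⟨M, rfl⟩ := exists_smul_upVector p
  have hu := right_ne_zero_of_mul_eq_one (im_base_smul_upVector_mul M)
  set z : ℂ := ((M • upVector).base : ℂ)
  set u : ℂ := M 1 0 * Complex.I + M 1 1 with hu_def
  set u' : ℂ := M 1 0 * -Complex.I + M 1 1 with hu'_def
  have key : ((M • upVector).vec * (b - conj z) - Complex.I * (M • upVector).base.im * (b - z))
      * (u * (u * u')) = 2 * (b * M 1 0 - M 0 0) := by
    linear_combination (b - conj z) * u' * vec_smul_upVector_mul M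
      - Complex.I * (b - z) * u * im_base_smul_upVector_mul M
      + Complex.I * coe_base_smul_upVector_mul M - Complex.I * conj_base_smul_upVector_mul M
      + Complex.I * b * (hu'_def - hu_def) + 2 * (M 0 0 - b * M 1 0) * Complex.I_sq
  rw [isForwardEndpoint_smul_upVector_iff, ← sub_eq_zero (b := _ * (_ - z)),
    ← mul_left_inj' (mul_ne_zero (left_ne_zero_of_mul hu) hu), key, zero_mul]
  norm_cast
  constructor <;> intro h <;> linarith

theorem isBackwardEndpoint_iff_vec_mul : IsBackwardEndpoint p a ↔
    p.vec * (a - conj (p.base : ℂ)) = -(Complex.I * p.base.im * (a - p.base)) := by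
  obtain ⟨M, rfl⟩ := exists_smul_upVector p
  have hu := right_ne_zero_of_mul_eq_one (im_base_smul_upVector_mul M)
  set z : ℂ := ((M • upVector).base : ℂ)
  set u : ℂ := M 1 0 * Complex.I + M 1 1 with hu_def
  set u' : ℂ := M 1 0 * -Complex.I + M 1 1 with hu'_def
  have key : ((M • upVector).vec * (a - conj z) - -(Complex.I * (M • upVector).base.im * (a - z)))
      * (u * (u * u')) = 2 * (a * M 1 1 - M 0 1) * Complex.I := by
    linear_combination (a - conj z) * u' * vec_smul_upVector_mul M
      + Complex.I * (a - z) * u * im_base_smul_upVector_mul M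
      - Complex.I * coe_base_smul_upVector_mul M - Complex.I * conj_base_smul_upVector_mul M
      + Complex.I * a * (hu'_def + hu_def)
  rw [isBackwardEndpoint_smul_upVector_iff, ← sub_eq_zero (b := -(_ * (_ - z))),
    ← mul_left_inj' (mul_ne_zero (left_ne_zero_of_mul hu) hu), key, zero_mul,
    mul_eq_zero_iff_right Complex.I_ne_zero]
  norm_cast
  constructor <;> intro h <;> linarith

end Tangents

/-- A unit vector `p` based on the positive imaginary axis that is tangent to the geodesic from the
real endpoint `a` to the real endpoint `b`; unlike in `IsSectionLift`, the size of `b` is not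
normalized, so that the notion is stable under the inversion `S`. -/
structure IsAxisVector (p : UnitTangent) (a b : ℝ) : Prop where
  re_base : p.base.re = 0
  backward : IsBackwardEndpoint p a
  forward : IsForwardEndpoint p b

theorem coe_of_re_eq_zero {z : ℍ} (h : z.re = 0) : (z : ℂ) = Complex.I * z.im := by
  apply Complex.ext <;> simp [h]

theorem isAxisVector_iff_vec_mul {p : UnitTangent} {a b : ℝ} : IsAxisVector p a b ↔
    p.base.re = 0 ∧
    p.vec * (a + Complex.I * p.base.im)
      = -(Complex.I * p.base.im * (a - Complex.I * p.base.im)) ∧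
    p.vec * (b + Complex.I * p.base.im)
      = Complex.I * p.base.im * (b - Complex.I * p.base.im) := by
  have hconj (h0 : p.base.re = 0) (x : ℝ) :
      (x - conj (p.base : ℂ) = x + Complex.I * p.base.im) ∧
        ((x : ℂ) - p.base = x - Complex.I * p.base.im) := by
    simp [coe_of_re_eq_zero h0]
  constructor
  · rintro ⟨h0, ha, hb⟩
    rw [isBackwardEndpoint_iff_vec_mul, (hconj h0 a).1, (hconj h0 a).2] at ha
    rw [isForwardEndpoint_iff_vec_mul, (hconj h0 b).1, (hconj h0 b).2] at hb
    exact ⟨h0, ha, hb⟩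
  · rintro ⟨h0, ha, hb⟩
    rw [← (hconj h0 a).1, ← (hconj h0 a).2, ← isBackwardEndpoint_iff_vec_mul] at ha
    rw [← (hconj h0 b).1, ← (hconj h0 b).2, ← isForwardEndpoint_iff_vec_mul] at hb
    exact ⟨h0, ha, hb⟩

theorem add_I_mul_im_ne_zero (x : ℝ) (z : ℍ) : (x + Complex.I * z.im : ℂ) ≠ 0 := by
  intro h
  simpa [z.im_ne_zero] using congrArg Complex.im h

theorem exists_isAxisVector {a b : ℝ} (hab : a * b < 0) : ∃ p, IsAxisVector p a b := by
  let z : ℍ := ⟨⟨0, √(-(a * b))⟩, Real.sqrt_pos.mpr (neg_pos.mpr hab)⟩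
  have hsq : (z.im : ℂ) ^ 2 = -(a * b) := by
    exact_mod_cast Real.sq_sqrt (neg_pos.mpr hab).le
  have hne := add_I_mul_im_ne_zero b z
  have hconj : (b - Complex.I * z.im : ℂ) = conj (b + Complex.I * z.im : ℂ) := by
    simp [sub_eq_add_neg]
  let p : UnitTangent :=
    { base := z
      vec := Complex.I * z.im * (b - Complex.I * z.im) / (b + Complex.I * z.im)
      norm_vec := by
        rw [mul_div_assoc, hconj, norm_mul, norm_div, Complex.norm_conj,
          div_self (norm_ne_zero_iff.mpr hne)]
        simp [abs_of_pos z.im_pos] }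
  refine ⟨p, isAxisVector_iff_vec_mul.mpr ⟨rfl, ?_, div_mul_cancel₀ _ hne⟩⟩
  rw [div_mul_eq_mul_div, div_eq_iff hne]
  linear_combination 2 * Complex.I * z.im * (hsq - z.im ^ 2 * Complex.I_sq)

theorem exists_isAxisVector_of_vec_re_ne_zero {p : UnitTangent} (h0 : p.base.re = 0)
    (hv : p.vec.re ≠ 0) : ∃ a b, IsAxisVector p a b := by
  have hnorm : (p.vec.re ^ 2 + p.vec.im ^ 2 : ℂ) = p.base.im ^ 2 := by
    norm_cast
    rw [← p.norm_vec, ← Complex.normSq_eq_norm_sq, Complex.normSq_apply, sq, sq]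
  have hvec := Complex.re_add_im p.vec
  have hv' : (p.vec.re : ℂ) ≠ 0 := Complex.ofReal_ne_zero.mpr hv
  refine ⟨p.base.im * (p.vec.im - p.base.im) / p.vec.re,
    p.base.im * (p.vec.im + p.base.im) / p.vec.re, isAxisVector_iff_vec_mul.mpr ⟨h0, ?_, ?_⟩⟩
  all_goals
    generalize p.vec.re = x, p.vec.im = w at *
    rw [← hvec]
    push_cast
    field_simp
  · linear_combination p.base.im * Complex.I * hnorm
      + x * p.base.im * (w - p.base.im) * Complex.I_sq
  · linear_combination p.base.im * Complex.I * hnorm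
      + x * p.base.im * (w + p.base.im) * Complex.I_sq

namespace IsAxisVector

variable {p q : UnitTangent} {a b a' b' : ℝ}

theorem im_sq (h : IsAxisVector p a b) : p.base.im ^ 2 = -(a * b) := by
  obtain ⟨-, ha, hb⟩ := isAxisVector_iff_vec_mul.mp h
  have hy : (Complex.I * p.base.im : ℂ) ≠ 0 :=
    mul_ne_zero Complex.I_ne_zero (Complex.ofReal_ne_zero.mpr p.base.im_ne_zero)
  have : (2 * (Complex.I * p.base.im)) * (p.base.im ^ 2 : ℂ)
      = (2 * (Complex.I * p.base.im)) * (-(a * b)) := by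
    linear_combination (b + Complex.I * p.base.im) * ha - (a + Complex.I * p.base.im) * hb
      + 2 * Complex.I * p.base.im ^ 3 * Complex.I_sq
  exact_mod_cast mul_left_cancel₀ (mul_ne_zero two_ne_zero hy) this

theorem mul_endpoints_neg (h : IsAxisVector p a b) : a * b < 0 := by
  have := h.im_sq
  have := pow_pos p.base.im_pos 2
  linarith

theorem backward_ne_zero (h : IsAxisVector p a b) : a ≠ 0 :=
  left_ne_zero_of_mul h.mul_endpoints_neg.ne

theorem forward_ne_zero (h : IsAxisVector p a b) : b ≠ 0 :=
  right_ne_zero_of_mul h.mul_endpoints_neg.ne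

theorem vec_re_ne_zero (h : IsAxisVector p a b) : p.vec.re ≠ 0 := by
  obtain ⟨-, -, hb⟩ := isAxisVector_iff_vec_mul.mp h
  intro hv
  have hre : -(p.vec.im * p.base.im) = p.base.im * p.base.im := by
    simpa [hv] using congrArg Complex.re hb
  have him : p.vec.im * b = p.base.im * b := by
    simpa [hv] using congrArg Complex.im hb
  have hvec : p.vec.im = p.base.im := mul_right_cancel₀ h.forward_ne_zero him
  rw [hvec] at hre
  linarith [mul_pos p.base.im_pos p.base.im_pos]

theorem eq_of_endpoints (hp : IsAxisVector p a b) (hq : IsAxisVector q a b) : p = q := by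
  have him : p.base.im = q.base.im :=
    (sq_eq_sq₀ p.base.im_pos.le q.base.im_pos.le).mp (hp.im_sq.trans hq.im_sq.symm)
  apply UnitTangent.ext
  · exact UpperHalfPlane.ext_re_im (hp.re_base.trans hq.re_base.symm) him
  · refine mul_right_cancel₀ (add_I_mul_im_ne_zero b p.base) ?_
    rw [(isAxisVector_iff_vec_mul.mp hp).2.2, him, (isAxisVector_iff_vec_mul.mp hq).2.2]

theorem endpoints_unique (h : IsAxisVector p a b) (h' : IsAxisVector p a' b') :
    a = a' ∧ b = b' :=
  ⟨Complex.ofReal_injective (tendsto_nhds_unique h.backward h'.backward),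
    Complex.ofReal_injective (tendsto_nhds_unique h.forward h'.forward)⟩

theorem S_smul (h : IsAxisVector p a b) : IsAxisVector (ModularGroup.S • p) (-a⁻¹) (-b⁻¹) where
  re_base := by
    change (ModularGroup.S • p.base).re = 0
    rw [UpperHalfPlane.modular_S_smul, UpperHalfPlane.mk_re, Complex.inv_re, Complex.neg_re,
      UpperHalfPlane.coe_re, h.re_base, neg_zero, zero_div]
  backward := h.backward.int_smul (by simp [ModularGroup.coe_S, h.backward_ne_zero])
  forward := h.forward.int_smul (by simp [ModularGroup.coe_S, h.forward_ne_zero])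

theorem T_zpow_smul_geodesicFlow (h : IsAxisVector p a b) {s : ℝ} {n : ℤ}
    (hn : (geodesicFlow s p).base.re = -n) :
    IsAxisVector (ModularGroup.T ^ n • geodesicFlow s p) (a + n) (b + n) where
  re_base := by
    change (ModularGroup.T ^ n • (geodesicFlow s p).base).re = 0
    rw [ModularGroup.re_T_zpow_smul, hn, neg_add_cancel]
  backward := (h.backward.geodesicFlow s).int_smul (by simp [ModularGroup.coe_T_zpow])
  forward := (h.forward.geodesicFlow s).int_smul (by simp [ModularGroup.coe_T_zpow])

theorem coe_base_geodesicFlow_mul (h : IsAxisVector p a b) (t : ℝ) :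
    ((geodesicFlow t p).base : ℂ) * (b + p.base.im * Real.exp t * Complex.I)
      = b * (a + p.base.im * Real.exp t * Complex.I) := by
  obtain ⟨M, rfl⟩ := exists_smul_upVector p
  have hflow := coe_base_geodesicFlow_smul_upVector_mul t M
  have hbase := coe_base_smul_upVector_mul M
  have ha := isBackwardEndpoint_smul_upVector_iff.mp h.backward
  have hb := isForwardEndpoint_smul_upVector_iff.mp h.forward
  rw [coe_of_re_eq_zero h.re_base] at hbase
  rw [ha, hb, Complex.ofReal_mul, Complex.ofReal_mul] at hflow
  have hM : M 1 0 ≠ 0 := fun hM => by simpa [ha, hb, hM] using det_fin_two_eq_one M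
  have him : ((M • upVector).base.im * M 1 1 : ℂ) = b * M 1 0 := by
    exact_mod_cast by simpa [ha, hb] using congrArg Complex.im hbase
  refine mul_right_cancel₀ (Complex.ofReal_ne_zero.mpr hM) ?_
  linear_combination (M • upVector).base.im * hflow
    + (a - (geodesicFlow t (M • upVector)).base) * him

theorem re_im_geodesicFlow (h : IsAxisVector p a b) (t : ℝ) :
    (geodesicFlow t p).base.re * b - (geodesicFlow t p).base.im * (p.base.im * Real.exp t)
        = b * a ∧
      (geodesicFlow t p).base.re * (p.base.im * Real.exp t) + (geodesicFlow t p).base.im * b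
        = b * (p.base.im * Real.exp t) := by
  have hflow := h.coe_base_geodesicFlow_mul t
  rw [← Complex.ofReal_mul] at hflow
  generalize p.base.im * Real.exp t = k at hflow ⊢
  constructor
  · simpa using congrArg Complex.re hflow
  · simpa using congrArg Complex.im hflow

theorem sq_im_mul_exp (h : IsAxisVector p a b) (t : ℝ) :
    (p.base.im * Real.exp t) ^ 2 = -(a * b) * Real.exp (2 * t) := by
  rw [mul_pow, h.im_sq, ← Real.exp_nat_mul, Nat.cast_two]

theorem re_geodesicFlow_mul (h : IsAxisVector p a b) (t : ℝ) :
    (geodesicFlow t p).base.re * (b - a * Real.exp (2 * t)) = a * b * (1 - Real.exp (2 * t)) := by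
  obtain ⟨hre, him⟩ := h.re_im_geodesicFlow t
  refine mul_right_cancel₀ h.forward_ne_zero ?_
  linear_combination b * hre + p.base.im * Real.exp t * him
    + (b - (geodesicFlow t p).base.re) * h.sq_im_mul_exp t

theorem normSq_geodesicFlow_mul (h : IsAxisVector p a b) (t : ℝ) :
    Complex.normSq (geodesicFlow t p).base * (b - a * Real.exp (2 * t))
      = a * b * (a - b * Real.exp (2 * t)) := by
  obtain ⟨hre, him⟩ := h.re_im_geodesicFlow t
  rw [Complex.normSq_apply, UpperHalfPlane.coe_re, UpperHalfPlane.coe_im]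
  refine mul_right_cancel₀ h.forward_ne_zero ?_
  set z := (geodesicFlow t p).base
  set k := p.base.im * Real.exp t
  linear_combination (z.re * b - z.im * k + b * a) * hre + (z.re * k + z.im * b + b * k) * him
    + (b ^ 2 - z.re * z.re - z.im * z.im) * h.sq_im_mul_exp t

end IsAxisVector

section Crossings

theorem mul_nonneg_of_isUnit_det {a b c d : ℤ} (h : IsUnit (a * d - b * c)) :
    0 ≤ a * c * (b * d) := by
  -- `a * d` and `b * c` are consecutive integers, so they do not have opposite signs
  rw [show a * c * (b * d) = a * d * (b * c) by ring]
  rcases Int.isUnit_iff.mp h with h | h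
  · rcases lt_or_ge (b * c) 0 with hbc | hbc
    · exact mul_nonneg_of_nonpos_of_nonpos (by lia) hbc.le
    · exact mul_nonneg (by lia) hbc
  · rcases lt_or_ge (a * d) 0 with had | had
    · exact mul_nonneg_of_nonpos_of_nonpos had.le (by lia)
    · exact mul_nonneg had (by lia)

theorem eq_zero_of_add_eq_zero {A B C : ℤ} {P Q R : ℝ} (hP : 0 < P) (hQ : 0 ≤ Q) (hR : 0 ≤ R)
    (hAB : 0 ≤ A * B) (hAC : 0 ≤ A * C) (h : A * P + B * Q + C * R = 0) : A = 0 := by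
  have hsum : A ^ 2 * P + (A * B : ℤ) * Q + (A * C : ℤ) * R = 0 := by
    push_cast
    linear_combination A * h
  have hB : 0 ≤ (A * B : ℤ) * Q := mul_nonneg (Int.cast_nonneg hAB) hQ
  have hC : 0 ≤ (A * C : ℤ) * R := mul_nonneg (Int.cast_nonneg hAC) hR
  have hsq : A ^ 2 * P = 0 := by linarith [mul_nonneg (sq_nonneg (A : ℝ)) hP.le]
  simpa using (mul_eq_zero_iff_right hP.ne').mp hsq

theorem re_smul_mul_normSq_denom (g : SL(2, ℝ)) (z : ℍ) :
    (g • z).re * Complex.normSq (g 1 0 * z + g 1 1) = g 0 0 * g 1 0 * Complex.normSq z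
      + (g 0 0 * g 1 1 + g 0 1 * g 1 0) * z.re + g 0 1 * g 1 1 := by
  have h := congrArg (fun w => (w * (starRingEnd ℂ) (g 1 0 * z + g 1 1)).re)
    (coe_smul_mul_denom g z)
  simp only [mul_assoc, Complex.mul_conj, Complex.re_mul_ofReal, UpperHalfPlane.coe_re] at h
  rw [h, Complex.normSq_apply]
  simp only [Complex.mul_re, Complex.add_re, Complex.add_im, Complex.mul_im, Complex.ofReal_re,
    Complex.ofReal_im, map_add, map_mul, Complex.conj_ofReal, Complex.conj_re, Complex.conj_im,
    UpperHalfPlane.coe_re]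
  ring

theorem re_smul_eq_zero_iff {γ : SL(2, ℤ)} {z : ℍ} :
    (γ • z).re = 0 ↔ (γ 0 0 * γ 1 0 : ℤ) * Complex.normSq z
      + (γ 0 0 * γ 1 1 + γ 0 1 * γ 1 0 : ℤ) * z.re + (γ 0 1 * γ 1 1 : ℤ) = 0 := by
  have h := re_smul_mul_normSq_denom γ z
  have hne := (Complex.normSq_pos.mpr (denom_ne_zero γ z)).ne'
  push_cast
  exact ((mul_eq_zero_iff_right hne).symm.trans (Eq.congr_left h))

theorem re_smul_ne_zero_of_mem_triangle (γ : SL(2, ℤ)) {z : ℍ} {ε : ℤˣ} (h0 : 0 < (ε : ℤ) * z.re)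
    (h1 : (ε : ℤ) * z.re < 1) (hz : (ε : ℤ) * z.re < Complex.normSq z) : (γ • z).re ≠ 0 := by
  intro hre
  rw [re_smul_eq_zero_iff] at hre
  have hdet := det_fin_two_eq_one γ
  generalize γ 0 0 = a, γ 0 1 = b, γ 1 0 = c, γ 1 1 = d at hre hdet
  have hε : (ε : ℤ) * ε = 1 := Int.units_coe_mul_self ε
  have hεR : ((ε : ℤ) : ℝ) * (ε : ℤ) = 1 := by exact_mod_cast hε
  have hsum : (a * c : ℤ) * (Complex.normSq z - (ε : ℤ) * z.re)
      + ((a * ε + b) * (c * ε + d) : ℤ) * ((ε : ℤ) * z.re)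
      + (b * d : ℤ) * (1 - (ε : ℤ) * z.re) = 0 := by
    push_cast at hre ⊢
    linear_combination hre + (a * c * ε * z.re + (a * d + b * c) * z.re) * hεR
  have hac_bd : 0 ≤ a * c * (b * d) := mul_nonneg_of_isUnit_det (hdet ▸ isUnit_one)
  have hac : 0 ≤ a * c * ((a * ε + b) * (c * ε + d)) :=
    mul_nonneg_of_isUnit_det (by convert isUnit_one using 1; linear_combination hdet)
  have hbd : 0 ≤ b * d * ((a * ε + b) * (c * ε + d)) := by
    rw [mul_comm]
    exact mul_nonneg_of_isUnit_det (by convert ε.isUnit using 1; linear_combination ε * hdet)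
  have hac0 : a * c = 0 :=
    eq_zero_of_add_eq_zero (sub_pos.mpr hz) h0.le (sub_pos.mpr h1).le hac hac_bd hsum
  have hbd0 : b * d = 0 :=
    eq_zero_of_add_eq_zero (sub_pos.mpr h1) (sub_pos.mpr hz).le h0.le
      ((mul_comm _ _).trans_ge hac_bd) hbd (by linarith)
  have hC0 : (a * ε + b) * (c * ε + d) = 0 := by
    simp only [hac0, hbd0, Int.cast_zero, zero_mul, zero_add, add_zero] at hsum
    exact_mod_cast (mul_eq_zero_iff_right h0.ne').mp hsum
  have : a * d + b * c = 0 := by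
    refine (mul_eq_zero_iff_left ε.ne_zero).mp ?_
    linear_combination hC0 - ε * ε * hac0 - hbd0
  omega

theorem apply_eq_zero_of_re_eq_zero {γ : SL(2, ℤ)} {z : ℍ} (hz : z.re = 0)
    (hγ : (γ • z).re = 0) : γ 0 1 = 0 ∧ γ 1 0 = 0 ∨ γ 0 0 = 0 ∧ γ 1 1 = 0 := by
  rw [re_smul_eq_zero_iff, hz] at hγ
  have hdet := det_fin_two_eq_one γ
  have hN : 0 < Complex.normSq z := Complex.normSq_pos.mpr z.ne_zero
  have hac : γ 0 0 * γ 1 0 = 0 :=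
    eq_zero_of_add_eq_zero hN zero_le_one le_rfl
      (mul_nonneg_of_isUnit_det (hdet ▸ isUnit_one)) (mul_zero _).ge (by simpa using hγ)
  have hbd : γ 0 1 * γ 1 1 = 0 := by
    simp only [hac, Int.cast_zero, zero_mul, mul_zero, zero_add] at hγ
    exact_mod_cast hγ
  rcases mul_eq_zero.mp hac with h | h <;> rcases mul_eq_zero.mp hbd with h' | h' <;>
    simp [h, h'] at hdet ⊢

theorem int_neg_smul (γ : SL(2, ℤ)) (p : UnitTangent) : -γ • p = γ • p := by
  change ((-γ : SL(2, ℤ)) : SL(2, ℝ)) • p = _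
  rw [Matrix.SpecialLinearGroup.coe_int_neg]
  exact UnitTangent.neg_smul _ p

theorem smul_eq_self_of_apply_eq_zero {γ : SL(2, ℤ)} (h01 : γ 0 1 = 0) (h10 : γ 1 0 = 0)
    (p : UnitTangent) : γ • p = p := by
  have h : γ 0 0 * γ 1 1 = 1 := by simpa [h01] using det_fin_two_eq_one γ
  have hγ : γ = 1 ∨ γ = -1 := by
    rcases Int.mul_eq_one_iff_eq_one_or_neg_one.mp h with ⟨h00, h11⟩ | ⟨h00, h11⟩
    · left
      ext i j
      fin_cases i <;> fin_cases j <;> simp [h00, h11, h01, h10]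
    · right
      ext i j
      fin_cases i <;> fin_cases j <;> simp [h00, h11, h01, h10]
  rcases hγ with rfl | rfl
  · exact one_smul _ p
  · rw [int_neg_smul, one_smul]

theorem S_smul_S_smul (p : UnitTangent) : ModularGroup.S • ModularGroup.S • p = p := by
  have hS : ModularGroup.S * ModularGroup.S = (-1 : SL(2, ℤ)) :=
    Subtype.ext ModularGroup.S_mul_S_eq
  rw [← mul_smul, hS, int_neg_smul, one_smul]

theorem smul_eq_self_or_S_smul {γ : SL(2, ℤ)} {p : UnitTangent} (hp : p.base.re = 0)
    (hγ : (γ • p).base.re = 0) : γ • p = p ∨ γ • p = ModularGroup.S • p := by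
  rcases apply_eq_zero_of_re_eq_zero hp hγ with ⟨h01, h10⟩ | ⟨h00, h11⟩
  · exact Or.inl (smul_eq_self_of_apply_eq_zero h01 h10 p)
  · right
    have hS : (ModularGroup.S * γ) • p = p :=
      smul_eq_self_of_apply_eq_zero (by simp [ModularGroup.coe_S, Matrix.mul_apply, h11])
        (by simp [ModularGroup.coe_S, Matrix.mul_apply, h00]) p
    rw [← S_smul_S_smul (γ • p), ← mul_smul ModularGroup.S γ, hS]

end Crossings

section Coordinates

/-- A unit vector `p` on the positive imaginary axis has coordinates `(U, W, ε)` if its geodesic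
runs from `-ε (W⁻¹ - 1)` to `ε U⁻¹`. These are the coordinates of `HasCoordinates` on `T₁ℍ`; they
also make sense for `1 < U`, where the forward endpoint lies inside the unit interval. -/
structure IsCoordinateLift (p : UnitTangent) (U W : ℝ) (ε : ℤˣ) : Prop where
  pos : 0 < U
  mem_Ioo : W ∈ Ioo 0 1
  isAxisVector : IsAxisVector p (-((ε : ℤ) * (W⁻¹ - 1))) ((ε : ℤ) * U⁻¹)

variable {p q : UnitTangent} {x : ModularTangent} {U W U' W' : ℝ} {ε ε' : ℤˣ}

theorem units_cast_mul_self (ε : ℤˣ) : ((ε : ℤ) : ℝ) * (ε : ℤ) = 1 := by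
  exact_mod_cast Int.units_coe_mul_self ε

theorem abs_units_cast_mul (ε : ℤˣ) (r : ℝ) : |(ε : ℤ) * r| = |r| := by
  rw [abs_mul, ← Int.cast_abs, Int.isUnit_iff_abs_eq.mp ε.isUnit, Int.cast_one, one_mul]

theorem inv_sub_one_pos (hW : W ∈ Ioo 0 1) : 0 < W⁻¹ - 1 :=
  sub_pos.mpr ((one_lt_inv₀ hW.1).mpr hW.2)

theorem sign_units_cast_mul (ε : ℤˣ) {r : ℝ} (hr : 0 < r) :
    Real.sign ((ε : ℤ) * r) = (ε : ℤ) := by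
  rcases Int.units_eq_one_or ε with rfl | rfl
  · simpa using Real.sign_of_pos hr
  · simpa using Real.sign_of_neg (neg_lt_zero.mpr hr)

theorem exists_units_cast_eq_sign {r : ℝ} (hr : r ≠ 0) :
    ∃ ε : ℤˣ, ((ε : ℤ) : ℝ) = Real.sign r := by
  rcases hr.lt_or_gt with hr | hr
  · exact ⟨-1, by simp [Real.sign_of_neg hr]⟩
  · exact ⟨1, by simp [Real.sign_of_pos hr]⟩

theorem isCoordinateLift_iff_exists_endpoints : IsCoordinateLift p U W ε ↔
    ∃ a b, IsAxisVector p a b ∧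
      U = |b|⁻¹ ∧ W = (1 + |a|)⁻¹ ∧ ((ε : ℤ) : ℝ) = Real.sign b := by
  constructor
  · rintro ⟨hU, hW, h⟩
    refine ⟨_, _, h, ?_, ?_, (sign_units_cast_mul ε (inv_pos.mpr hU)).symm⟩
    · rw [abs_units_cast_mul, abs_of_pos (inv_pos.mpr hU), inv_inv]
    · rw [abs_neg, abs_units_cast_mul, abs_of_pos (inv_sub_one_pos hW), add_sub_cancel, inv_inv]
  · rintro ⟨a, b, h, rfl, rfl, hε⟩
    have hsign : (ε : ℤ) * |b| = b ∧ -((ε : ℤ) * |a|) = a := by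
      have hab := h.mul_endpoints_neg
      rw [hε]
      rcases h.forward_ne_zero.lt_or_gt with hb | hb
      · have ha := pos_of_mul_neg_left hab hb.le
        simp [Real.sign_of_neg hb, abs_of_neg hb, abs_of_pos ha]
      · have ha := neg_of_mul_neg_left hab hb.le
        simp [Real.sign_of_pos hb, abs_of_pos hb, abs_of_neg ha]
    refine ⟨inv_pos.mpr (abs_pos.mpr h.forward_ne_zero), ⟨by positivity, ?_⟩, ?_⟩
    · exact inv_lt_one_of_one_lt₀ (lt_add_of_pos_right 1 (abs_pos.mpr h.backward_ne_zero))
    · rwa [inv_inv, inv_inv, add_sub_cancel_left, hsign.1, hsign.2]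

theorem exists_isCoordinateLift (hU : 0 < U) (hW : W ∈ Ioo 0 1) (ε : ℤˣ) :
    ∃ p, IsCoordinateLift p U W ε := by
  obtain ⟨p, hp⟩ := exists_isAxisVector
    (a := -((ε : ℤ) * (W⁻¹ - 1))) (b := (ε : ℤ) * U⁻¹) (by
      have := mul_pos (inv_sub_one_pos hW) (inv_pos.mpr hU)
      linear_combination this - (W⁻¹ - 1) * U⁻¹ * units_cast_mul_self ε)
  exact ⟨p, hU, hW, hp⟩

theorem exists_isCoordinateLift_iff :
    (∃ U W ε, IsCoordinateLift p U W ε) ↔ p.base.re = 0 ∧ p.vec.re ≠ 0 := by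
  constructor
  · rintro ⟨U, W, ε, h⟩
    exact ⟨h.isAxisVector.re_base, h.isAxisVector.vec_re_ne_zero⟩
  · rintro ⟨h0, hv⟩
    obtain ⟨a, b, h⟩ := exists_isAxisVector_of_vec_re_ne_zero h0 hv
    obtain ⟨ε, hε⟩ := exists_units_cast_eq_sign h.forward_ne_zero
    exact ⟨_, _, ε, isCoordinateLift_iff_exists_endpoints.mpr ⟨a, b, h, rfl, rfl, hε⟩⟩

namespace IsCoordinateLift

theorem eq_of_coordinates (hp : IsCoordinateLift p U W ε) (hq : IsCoordinateLift q U W ε) :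
    p = q :=
  hp.isAxisVector.eq_of_endpoints hq.isAxisVector

theorem coordinates_unique (h : IsCoordinateLift p U W ε) (h' : IsCoordinateLift p U' W' ε') :
    U' = U ∧ W' = W ∧ ε' = ε := by
  obtain ⟨a, b, hab, rfl, rfl, hε⟩ := isCoordinateLift_iff_exists_endpoints.mp h
  obtain ⟨a', b', hab', rfl, rfl, hε'⟩ := isCoordinateLift_iff_exists_endpoints.mp h'
  obtain ⟨rfl, rfl⟩ := hab.endpoints_unique hab'
  exact ⟨rfl, rfl, Units.ext (Int.cast_injective (hε'.trans hε.symm))⟩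

theorem one_sub_mem_Ioo (h : IsCoordinateLift p U W ε) : 1 - W ∈ Ioo 0 1 :=
  ⟨sub_pos.mpr h.mem_Ioo.2, sub_lt_self 1 h.mem_Ioo.1⟩

theorem S_smul (h : IsCoordinateLift p U W ε) :
    IsCoordinateLift (ModularGroup.S • p) U⁻¹ (1 - W) (-ε) where
  pos := inv_pos.mpr h.pos
  mem_Ioo := h.one_sub_mem_Ioo
  isAxisVector := by
    have hε : ((ε : ℤ) : ℝ)⁻¹ = (ε : ℤ) := inv_eq_of_mul_eq_one_left (units_cast_mul_self ε)
    have hW := h.mem_Ioo.1.ne'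
    have h1W := h.one_sub_mem_Ioo.1.ne'
    convert h.isAxisVector.S_smul using 1
    · rw [inv_neg, mul_inv, hε, Units.val_neg, Int.cast_neg]
      field_simp
      ring
    · rw [mul_inv, hε, Units.val_neg, Int.cast_neg, neg_mul]

theorem exists_smul_le_one (h : IsCoordinateLift p U W ε) :
    ∃ (γ : SL(2, ℤ)) (U' W' : ℝ) (ε' : ℤˣ), IsCoordinateLift (γ • p) U' W' ε' ∧ U' ≤ 1 := by
  rcases le_total U 1 with hU | hU
  · exact ⟨1, U, W, ε, (one_smul SL(2, ℤ) p).symm ▸ h, hU⟩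
  · exact ⟨_, _, _, _, h.S_smul, inv_le_one_of_one_le₀ hU⟩

theorem re_geodesicFlow_mul (h : IsCoordinateLift p U W ε) (s : ℝ) :
    (ε : ℤ) * (geodesicFlow s p).base.re * (W + U * (1 - W) * Real.exp (2 * s))
      = (1 - W) * (Real.exp (2 * s) - 1) := by
  have hre := h.isAxisVector.re_geodesicFlow_mul s
  have hU := h.pos.ne'
  have hW := h.mem_Ioo.1.ne'
  field_simp at hre
  linear_combination (ε : ℤ) * hre
    + (1 - W) * (Real.exp (2 * s) - 1) * units_cast_mul_self ε

theorem normSq_geodesicFlow_mul (h : IsCoordinateLift p U W ε) (s : ℝ) :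
    U * W * Complex.normSq (geodesicFlow s p).base * (W + U * (1 - W) * Real.exp (2 * s))
      = (1 - W) * (U * (1 - W) + W * Real.exp (2 * s)) := by
  have hnorm := h.isAxisVector.normSq_geodesicFlow_mul s
  have hU := h.pos.ne'
  have hW := h.mem_Ioo.1.ne'
  field_simp at hnorm
  linear_combination hnorm
    + (1 - W) * (U * (1 - W) + W * Real.exp (2 * s)) * units_cast_mul_self ε

theorem re_geodesicFlow_eq (h : IsCoordinateLift p U W ε) {s : ℝ}
    (hs : Real.exp (2 * s) * ((1 - U) * (1 - W)) = 1) : (geodesicFlow s p).base.re = (ε : ℤ) := by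
  have hre := h.re_geodesicFlow_mul s
  have hpos : 0 < W + U * (1 - W) * Real.exp (2 * s) :=
    add_pos h.mem_Ioo.1 (mul_pos (mul_pos h.pos h.one_sub_mem_Ioo.1) (Real.exp_pos _))
  refine mul_right_cancel₀ hpos.ne' ?_
  linear_combination (ε : ℤ) * hre - (geodesicFlow s p).base.re
    * (W + U * (1 - W) * Real.exp (2 * s)) * units_cast_mul_self ε + (ε : ℤ) * hs

theorem base_smul_geodesicFlow_re_ne_zero (h : IsCoordinateLift p U W ε) (hU : U ≤ 1) {s : ℝ}
    (hs0 : 0 < s) (hs : Real.exp (2 * s) * ((1 - U) * (1 - W)) < 1) (γ : SL(2, ℤ)) :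
    (γ • geodesicFlow s p).base.re ≠ 0 := by
  have hre := h.re_geodesicFlow_mul s
  have hnorm := h.normSq_geodesicFlow_mul s
  have hE : 1 < Real.exp (2 * s) := Real.one_lt_exp_iff.mpr (by positivity)
  have hU0 := h.pos
  have hW := h.mem_Ioo.1
  have h1W := h.one_sub_mem_Ioo.1
  have hD : 0 < W + U * (1 - W) * Real.exp (2 * s) := by positivity
  change (γ • (geodesicFlow s p).base).re ≠ 0
  generalize (geodesicFlow s p).base = z at hre hnorm ⊢
  refine re_smul_ne_zero_of_mem_triangle γ (ε := ε) ?_ ?_ ?_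
  · exact pos_of_mul_pos_left (hre ▸ mul_pos h1W (sub_pos.mpr hE)) hD.le
  · refine lt_of_mul_lt_mul_right ?_ hD.le
    linarith
  · refine lt_of_mul_lt_mul_left ?_ (mul_pos (mul_pos hU0 hW) hD).le
    have hUE : U * W * (Real.exp (2 * s) - 1) < U * (1 - W) + W * Real.exp (2 * s) := by
      linarith [mul_le_mul_of_nonneg_right hU (mul_pos hW (Real.exp_pos (2 * s))).le]
    linear_combination (1 - W) * hUE + U * W * hre - hnorm

theorem T_zpow_smul_geodesicFlow (h : IsCoordinateLift p U W ε) (hU : U < 1) {s : ℝ}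
    (hs : Real.exp (2 * s) * ((1 - U) * (1 - W)) = 1) :
    IsCoordinateLift (ModularGroup.T ^ (-(ε : ℤ)) • geodesicFlow s p) (U / (1 - U)) (W / (1 + W)) ε
    where
  pos := div_pos h.pos (sub_pos.mpr hU)
  mem_Ioo := by
    have hW := h.mem_Ioo.1
    exact ⟨by positivity, (div_lt_one (by positivity)).mpr (lt_one_add W)⟩
  isAxisVector := by
    have hU0 := h.pos.ne'
    have hW0 := h.mem_Ioo.1.ne'
    have hn : (geodesicFlow s p).base.re = -((-(ε : ℤ) : ℤ) : ℝ) := by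
      rw [h.re_geodesicFlow_eq hs, Int.cast_neg, neg_neg]
    convert h.isAxisVector.T_zpow_smul_geodesicFlow hn using 1
    · push_cast
      field_simp
      ring
    · push_cast
      field_simp
      ring

theorem exists_smul_geodesicFlow (h : IsCoordinateLift p U W ε) (hU : U < 1) {s : ℝ}
    (hs : Real.exp (2 * s) * ((1 - U) * (1 - W)) = 1) :
    ∃ γ : SL(2, ℤ), IsCoordinateLift (γ • geodesicFlow s p) (fareyExtension (U, W)).1
      (fareyExtension (U, W)).2 (if U ≤ 1 / 2 then ε else -ε) := by
  have hT := h.T_zpow_smul_geodesicFlow hU hs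
  rcases le_or_gt U (1 / 2) with hU2 | hU2
  · simp only [fareyExtension, if_pos hU2]
    exact ⟨_, hT⟩
  · have hW : 1 - W / (1 + W) = 1 / (1 + W) := by
      rw [one_sub_div (add_pos one_pos h.mem_Ioo.1).ne', add_sub_cancel_right]
    simp only [fareyExtension, if_neg hU2.not_ge]
    refine ⟨ModularGroup.S * ModularGroup.T ^ (-(ε : ℤ)), ?_⟩
    rw [mul_smul, ← hW, ← inv_div]
    exact hT.S_smul

end IsCoordinateLift

end Coordinates

section CrossSection

variable {x : ModularTangent} {p q : UnitTangent} {U W U' W' : ℝ} {ε ε' : ℤˣ}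

theorem toModular_eq_iff : toModular p = toModular q ↔ ∃ γ : SL(2, ℤ), γ • q = p :=
  Quotient.eq

theorem toModular_smul (γ : SL(2, ℤ)) (p : UnitTangent) : toModular (γ • p) = toModular p :=
  toModular_eq_iff.mpr ⟨γ, rfl⟩

theorem hasCoordinates_iff : HasCoordinates x U W ε ↔
    U ≤ 1 ∧ ∃ p, toModular p = x ∧ IsCoordinateLift p U W ε := by
  simp only [isCoordinateLift_iff_exists_endpoints]
  constructor
  · rintro ⟨p, a, b, hx, h, rfl, hcoord⟩
    exact ⟨inv_le_one_of_one_le₀ h.one_le_abs_forward, p, hx, a, b,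
      ⟨h.re_base, h.backward, h.forward⟩, rfl, hcoord⟩
  · rintro ⟨hU, p, hx, a, b, h, rfl, hcoord⟩
    exact ⟨p, a, b, hx, ⟨h.re_base, h.backward, h.forward, h.backward_ne_zero,
      (inv_le_one₀ (abs_pos.mpr h.forward_ne_zero)).mp hU⟩, rfl, hcoord⟩

theorem mem_crossSection_iff : x ∈ crossSection ↔ ∃ U W ε, HasCoordinates x U W ε := by
  constructor
  · rintro ⟨p, a, b, hx, h⟩
    have hb : b ≠ 0 := abs_pos.mp (one_pos.trans_le h.one_le_abs_forward)
    obtain ⟨ε, hε⟩ := exists_units_cast_eq_sign hb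
    exact ⟨_, _, ε, p, a, b, hx, h, rfl, rfl, hε⟩
  · rintro ⟨-, -, -, p, a, b, hx, h, -⟩
    exact ⟨p, a, b, hx, h⟩

theorem crossSection_eq :
    crossSection = {x | ∃ p, toModular p = x ∧ p.base.re = 0 ∧ p.vec.re ≠ 0} := by
  ext x
  simp only [mem_crossSection_iff, hasCoordinates_iff, mem_ofPred_eq, ← exists_isCoordinateLift_iff]
  constructor
  · rintro ⟨U, W, ε, -, p, hx, hp⟩
    exact ⟨p, hx, U, W, ε, hp⟩
  · rintro ⟨p, rfl, U, W, ε, hp⟩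
    obtain ⟨γ, U', W', ε', hγp, hU'⟩ := hp.exists_smul_le_one
    exact ⟨U', W', ε', hU', γ • p, toModular_smul γ p, hγp⟩

theorem exists_smul_re_eq_zero (h : toModular p ∈ crossSection) :
    ∃ γ : SL(2, ℤ), (γ • p).base.re = 0 := by
  obtain ⟨q, -, -, hq, h0, -⟩ := h
  obtain ⟨γ, rfl⟩ := toModular_eq_iff.mp hq
  exact ⟨γ, h0⟩

theorem existsUnique_hasCoordinates (hU : U ∈ Ioc 0 1) (hW : W ∈ Ioo 0 1) (ε : ℤˣ) :
    ∃! x, HasCoordinates x U W ε := by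
  simp only [hasCoordinates_iff]
  obtain ⟨p, hp⟩ := exists_isCoordinateLift hU.1 hW ε
  refine ⟨toModular p, ⟨hU.2, p, rfl, hp⟩, ?_⟩
  rintro _ ⟨-, q, rfl, hq⟩
  exact congrArg toModular (hq.eq_of_coordinates hp)

namespace HasCoordinates

theorem fst_mem_Ioc (h : HasCoordinates x U W ε) : U ∈ Ioc 0 1 := by
  obtain ⟨hU, p, -, hp⟩ := hasCoordinates_iff.mp h
  exact ⟨hp.pos, hU⟩

theorem snd_mem_Ioo (h : HasCoordinates x U W ε) : W ∈ Ioo 0 1 := by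
  obtain ⟨-, p, -, hp⟩ := hasCoordinates_iff.mp h
  exact hp.mem_Ioo

theorem inversion (h : HasCoordinates x 1 W ε) : HasCoordinates x 1 (1 - W) (-ε) := by
  obtain ⟨-, p, rfl, hp⟩ := hasCoordinates_iff.mp h
  have hS := hp.S_smul
  rw [inv_one] at hS
  exact hasCoordinates_iff.mpr ⟨le_rfl, _, toModular_smul _ p, hS⟩

theorem iff_eq_or_inversion (h : HasCoordinates x U W ε) : HasCoordinates x U' W' ε' ↔
    (U' = U ∧ W' = W ∧ ε' = ε) ∨ (U = 1 ∧ U' = 1 ∧ W' = 1 - W ∧ ε' = -ε) := by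
  constructor
  · intro h'
    obtain ⟨hU, p, rfl, hp⟩ := hasCoordinates_iff.mp h
    obtain ⟨hU', q, hqp, hq⟩ := hasCoordinates_iff.mp h'
    obtain ⟨γ, rfl⟩ := toModular_eq_iff.mp hqp
    rcases smul_eq_self_or_S_smul hp.isAxisVector.re_base hq.isAxisVector.re_base with hγ | hγ
    · exact Or.inl (hp.coordinates_unique (hγ ▸ hq))
    · obtain ⟨rfl, hW, hε⟩ := hp.S_smul.coordinates_unique (hγ ▸ hq)
      have hU1 : U = 1 := hU.antisymm ((inv_le_one₀ hp.pos).mp hU')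
      exact Or.inr ⟨hU1, by rw [hU1, inv_one], hW, hε⟩
  · rintro (⟨rfl, rfl, rfl⟩ | ⟨rfl, rfl, rfl, rfl⟩)
    · exact h
    · exact h.inversion

end HasCoordinates

end CrossSection

section FirstReturn

variable {x : ModularTangent} {U W : ℝ} {ε : ℤˣ}

theorem fareyExtension_fst_le_one (U W : ℝ) : (fareyExtension (U, W)).1 ≤ 1 := by
  rcases le_or_gt U (1 / 2) with hU | hU
  · simp only [fareyExtension, if_pos hU]
    rw [div_le_one (by linarith)]
    linarith
  · simp only [fareyExtension, if_neg hU.not_ge]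
    rw [div_le_one (by linarith)]
    linarith

theorem exp_two_mul_neg_half_log {r : ℝ} (hr : 0 < r) :
    Real.exp (2 * (-(1 / 2) * Real.log r)) * r = 1 := by
  rw [show 2 * (-(1 / 2) * Real.log r) = -Real.log r by ring, Real.exp_neg, Real.exp_log hr,
    inv_mul_cancel₀ hr.ne']

namespace HasCoordinates

theorem le_exp_of_mem_returnTimes (h : HasCoordinates x U W ε) {s : ℝ} (hs : s ∈ returnTimes x) :
    1 ≤ Real.exp (2 * s) * ((1 - U) * (1 - W)) := by
  obtain ⟨hU, p, rfl, hp⟩ := hasCoordinates_iff.mp h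
  obtain ⟨γ, hγ⟩ := exists_smul_re_eq_zero hs.2
  by_contra! hlt
  exact hp.base_smul_geodesicFlow_re_ne_zero hU hs.1 hlt γ hγ

theorem modularFlow (h : HasCoordinates x U W ε) (hU : U < 1) {s : ℝ}
    (hs : Real.exp (2 * s) * ((1 - U) * (1 - W)) = 1) :
    HasCoordinates (modularFlow s x) (fareyExtension (U, W)).1 (fareyExtension (U, W)).2
      (if U ≤ 1 / 2 then ε else -ε) := by
  obtain ⟨-, p, rfl, hp⟩ := hasCoordinates_iff.mp h
  obtain ⟨γ, hγ⟩ := hp.exists_smul_geodesicFlow hU hs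
  exact hasCoordinates_iff.mpr
    ⟨fareyExtension_fst_le_one U W, _, toModular_smul γ _, hγ⟩

theorem one_sub_mul_one_sub_mem_Ioo (h : HasCoordinates x U W ε) (hU : U < 1) :
    (1 - U) * (1 - W) ∈ Ioo 0 1 := by
  have hU0 := h.fst_mem_Ioc.1
  obtain ⟨hW0, hW1⟩ := h.snd_mem_Ioo
  exact ⟨mul_pos (sub_pos.mpr hU) (sub_pos.mpr hW1),
    mul_lt_one_of_nonneg_of_lt_one_left (sub_nonneg.mpr hU.le) (by linarith) (by linarith)⟩

theorem isLeast_returnTimes (h : HasCoordinates x U W ε) (hU : U < 1) :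
    IsLeast (returnTimes x) (-(1 / 2) * Real.log ((1 - U) * (1 - W))) := by
  have hr := h.one_sub_mul_one_sub_mem_Ioo hU
  have hexp := exp_two_mul_neg_half_log hr.1
  refine ⟨⟨?_, mem_crossSection_iff.mpr ⟨_, _, _, h.modularFlow hU hexp⟩⟩, fun s hs => ?_⟩
  · linarith [Real.log_neg hr.1 hr.2]
  · have hle := hexp.trans_le (h.le_exp_of_mem_returnTimes hs)
    have := Real.exp_le_exp.mp (le_of_mul_le_mul_right hle hr.1)
    linarith

theorem fst_lt_one (h : HasCoordinates x U W ε) (hx : (returnTimes x).Nonempty) : U < 1 := by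
  obtain ⟨s, hs⟩ := hx
  refine lt_of_le_of_ne h.fst_mem_Ioc.2 ?_
  rintro rfl
  have := h.le_exp_of_mem_returnTimes hs
  norm_num at this

end HasCoordinates

theorem isLeast_returnTime (x : returnDomain) : IsLeast (returnTimes x) (returnTime x) := by
  obtain ⟨r, hr⟩ := x.2.2
  rwa [returnTime, hr.csInf_eq]

theorem returnTimes_nonempty (x : returnDomain) : (returnTimes x).Nonempty :=
  ⟨_, (isLeast_returnTime x).1⟩

theorem mem_returnDomain_iff : x ∈ returnDomain ↔
    ∃ U ∈ Ioo (0 : ℝ) 1, ∃ W ∈ Ioo (0 : ℝ) 1, ∃ ε, HasCoordinates x U W ε := by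
  constructor
  · intro hx
    obtain ⟨U, W, ε, h⟩ := mem_crossSection_iff.mp hx.1
    have hU := h.fst_lt_one (returnTimes_nonempty ⟨x, hx⟩)
    exact ⟨U, ⟨h.fst_mem_Ioc.1, hU⟩, W, h.snd_mem_Ioo, ε, h⟩
  · rintro ⟨U, hU, W, -, ε, h⟩
    exact ⟨mem_crossSection_iff.mpr ⟨U, W, ε, h⟩, _, h.isLeast_returnTimes hU.2⟩

theorem HasCoordinates.returnTime_eq {x : returnDomain} (h : HasCoordinates x U W ε) :
    returnTime x = -(1 / 2) * Real.log ((1 - U) * (1 - W)) :=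
  (h.isLeast_returnTimes (h.fst_lt_one (returnTimes_nonempty x))).csInf_eq

theorem HasCoordinates.returnMap {x : returnDomain} (h : HasCoordinates x U W ε) :
    HasCoordinates (returnMap x) (fareyExtension (U, W)).1 (fareyExtension (U, W)).2
      (if U ≤ 1 / 2 then ε else -ε) := by
  have hU := h.fst_lt_one (returnTimes_nonempty x)
  refine h.modularFlow hU ?_
  rw [h.returnTime_eq]
  exact exp_two_mul_neg_half_log (h.one_sub_mul_one_sub_mem_Ioo hU).1

end FirstReturn

section CoordinateProjection

variable {x : ModularTangent} {U W U' W' : ℝ} {ε ε' : ℤˣ}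

theorem exists_normalized_coordinates (hx : x ∈ crossSection) :
    ∃ U W ε, HasCoordinates x U W ε ∧ (U < 1 ∨ W ≤ 1 / 2) := by
  obtain ⟨U, W, ε, h⟩ := mem_crossSection_iff.mp hx
  rcases h.fst_mem_Ioc.2.lt_or_eq with hU | rfl
  · exact ⟨U, W, ε, h, Or.inl hU⟩
  · rcases le_total W (1 / 2) with hW | hW
    · exact ⟨1, W, ε, h, Or.inr hW⟩
    · exact ⟨1, 1 - W, -ε, h.inversion, Or.inr (by linarith)⟩

theorem normalized_coordinates_unique (h : HasCoordinates x U W ε) (hn : U < 1 ∨ W ≤ 1 / 2)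
    (h' : HasCoordinates x U' W' ε') (hn' : U' < 1 ∨ W' ≤ 1 / 2) : (U, W) = (U', W') := by
  rcases h.iff_eq_or_inversion.mp h' with ⟨rfl, rfl, -⟩ | ⟨rfl, rfl, rfl, -⟩
  · rfl
  · have hW := hn.resolve_left (lt_irrefl _)
    have hW' := hn'.resolve_left (lt_irrefl _)
    rw [show 1 - W = W by linarith]

theorem existsUnique_isCoordinateProjection :
    ∃! π : crossSection → ℝ × ℝ, IsCoordinateProjection π := by
  choose U W ε h hn using fun x : crossSection => exists_normalized_coordinates x.2
  exact ⟨fun x => (U x, W x),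
    fun x _ _ _ h' hn' => normalized_coordinates_unique (h x) (hn x) h' hn',
    fun π hπ => funext fun x => hπ x _ _ _ (h x) (hn x)⟩

theorem fareyExtension_normalized (hW : W ∈ Icc 0 1) :
    (fareyExtension (U, W)).1 < 1 ∨ (fareyExtension (U, W)).2 ≤ 1 / 2 := by
  rcases le_or_gt U (1 / 2) with hU2 | hU2
  · right
    simp only [fareyExtension, if_pos hU2]
    rw [div_le_iff₀ (by linarith [hW.1])]
    linarith [hW.2]
  · left
    simp only [fareyExtension, if_neg hU2.not_ge]
    rw [div_lt_one (by linarith)]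
    linarith

namespace IsCoordinateProjection

variable {π : crossSection → ℝ × ℝ}

theorem mem_unitSquare (hπ : IsCoordinateProjection π) (x : crossSection) :
    π x ∈ Icc (0 : ℝ) 1 ×ˢ Icc (0 : ℝ) 1 := by
  obtain ⟨U, W, ε, h, hn⟩ := exists_normalized_coordinates x.2
  rw [hπ x U W ε h hn]
  exact ⟨Ioc_subset_Icc_self h.fst_mem_Ioc, Ioo_subset_Icc_self h.snd_mem_Ioo⟩

theorem semiconj (hπ : IsCoordinateProjection π) (x : returnDomain) :
    π (returnMap x) = fareyExtension (π ⟨x, x.2.1⟩) := by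
  obtain ⟨U, W, ε, h, hn⟩ := exists_normalized_coordinates x.2.1
  rw [hπ ⟨x, x.2.1⟩ U W ε h hn]
  exact hπ _ _ _ _ h.returnMap (fareyExtension_normalized (Ioo_subset_Icc_self h.snd_mem_Ioo))

end IsCoordinateProjection

end CoordinateProjection

end ModularFarey

theorem theorem2 :
    -- the cross section consists of the nonvertical vectors based on the positive imaginary axis
    crossSection = {x | ∃ p, toModular p = x ∧ p.base.re = 0 ∧ p.vec.re ≠ 0} ∧
    -- `(U, W, ε)` are coordinates on it, unique up to the identification at `U = 1`
    (∀ x ∈ crossSection, ∃ U ∈ Ioc (0 : ℝ) 1, ∃ W ∈ Ioo (0 : ℝ) 1, ∃ ε, HasCoordinates x U W ε) ∧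
    (∀ U ∈ Ioc (0 : ℝ) 1, ∀ W ∈ Ioo (0 : ℝ) 1, ∀ ε, ∃! x, HasCoordinates x U W ε) ∧
    (∀ x U W ε, HasCoordinates x U W ε → ∀ U' W' ε',
      (HasCoordinates x U' W' ε' ↔
        (U' = U ∧ W' = W ∧ ε' = ε) ∨ (U = 1 ∧ U' = 1 ∧ W' = 1 - W ∧ ε' = -ε))) ∧
    -- the return map is defined exactly at the points with `U < 1`
    (∀ x, x ∈ returnDomain ↔
      ∃ U ∈ Ioo (0 : ℝ) 1, ∃ W ∈ Ioo (0 : ℝ) 1, ∃ ε, HasCoordinates x U W ε) ∧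
    -- the return map and the return time in coordinates
    (∀ (x : returnDomain) (U W : ℝ) (ε : ℤˣ), HasCoordinates x U W ε →
      HasCoordinates (returnMap x) (fareyExtension (U, W)).1 (fareyExtension (U, W)).2
        (if U ≤ 1 / 2 then ε else -ε) ∧
      IsLeast (returnTimes x) (returnTime x) ∧
      returnTime x = -(1 / 2) * Real.log ((1 - U) * (1 - W))) ∧
    -- the natural extension of the Farey map is a factor of the return map
    (∃! π : crossSection → ℝ × ℝ, IsCoordinateProjection π) ∧
    (∀ π : crossSection → ℝ × ℝ, IsCoordinateProjection π →
      (∀ x, π x ∈ Icc (0 : ℝ) 1 ×ˢ Icc (0 : ℝ) 1) ∧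
      ∀ x : returnDomain, π (returnMap x) = fareyExtension (π ⟨x, x.2.1⟩)) := by
  refine ⟨crossSection_eq, fun x hx => ?_, fun U hU W hW ε => existsUnique_hasCoordinates hU hW ε,
    fun x U W ε h U' W' ε' => h.iff_eq_or_inversion, fun x => mem_returnDomain_iff,
    fun x U W ε h => ⟨h.returnMap, isLeast_returnTime x, h.returnTime_eq⟩,
    existsUnique_isCoordinateProjection, fun π hπ => ⟨hπ.mem_unitSquare, hπ.semiconj⟩⟩
  obtain ⟨U, W, ε, h⟩ := mem_crossSection_iff.mp hx
  exact ⟨U, h.fst_mem_Ioc, W, h.snd_mem_Ioo, ε, h⟩
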